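/- Let $a>b>c$ be real numbers. For $\lambda\ne -a,-b,-c$ let $\mathcal Q_\lambda$ be the confocal quadric $\frac{x^2}{\lambda+a}+\frac{y^2}{\lambda+b}+\frac{z^2}{\lambda+c}=1$ in $\mathbb R^3$. Let $k_1,k_2,k_3$ be given by $k_1^2=\frac{a-b}{a-c}$, $k_2^2=\frac{b-c}{a-c}$ and $k_3=k_1$, so that $k_2^2=1-k_1^2$. For real $s_1,s_2,s_3$ put $$\boldsymbol r=\begin{pmatrix}x\\y\\z\end{pmatrix}=\sqrt{a-c}\begin{pmatrix}\operatorname{sn}(s_1,k_1)\operatorname{dn}(s_2,k_2)\operatorname{ns}(s_3,k_3)\\ \operatorname{cn}(s_1,k_1)\operatorname{cn}(s_2,k_2)\operatorname{ds}(s_3,k_3)\\ \operatorname{dn}(s_1,k_1)\operatorname{sn}(s_2,k_2)\operatorname{cs}(s_3,k_3)\end{pmatrix}$$ with the Jacobi elliptic functions, and $$u_1=(a-b)\operatorname{sn}^2(s_1,k_1)-a,\qquad u_2=(b-c)\frac{\operatorname{dn}^2(s_2,k_2)}{k_2^2}-a,\qquad u_3=(a-c)\operatorname{ns}^2(s_3,k_3)-a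 .$$ (i) Let $\mathsf K(k)$ be the complete elliptic integral of the first kind. The functions $u_1(s_1),u_2(s_2),u_3(s_3)$ map the intervals $(0,\mathsf K(k_1))$, $(0,\mathsf K(k_2))$, $(0,\mathsf K(k_3))$ bijectively onto $(-a,-b)$, $(-b,-c)$, $(-c,\infty)$, respectively. Moreover, for all real $s_1,s_2,s_3$ such that $\operatorname{sn}(s_i,k_i)\ne0$ and $\operatorname{cn}(s_i,k_i)\neq 0$ for $i=1,2,3$ (that is, $\boldsymbol r$ is defined and lies in one of the open octants), the following hold. (ii) $-a<u_1<-b<u_2<-c<u_3$, and $\boldsymbol r$ lies on each of $\mathcal Q_{u_1},\mathcal Q_{u_2},\mathcal Q_{u_3}$. Thus $\boldsymbol r(s_1,s_2,s_3)$ is a parametrisation $u_i=u_i(s_i)$ of the confocal coordinate system. (iii) The second fundamental forms $\mathrm{II}_{ik}=-d\boldsymbol r\cdot d\boldsymbol N_{ik}$ of the coordinate surfaces $s_l=\mathrm{const}$ ($\{i,k,l\}=\{1,2,3\}$, $\boldsymbol N_{ik}$ a unit normal) are conformally flat, that is, up to a nonvanishing factor, $$\mathrm{II}_{12}\sim ds_1^2+ds_2^2,\qquad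 \mathrm{II}_{13}\sim ds_1^2-ds_3^2,\qquad \mathrm{II}_{23}\sim ds_2^2+ds_3^2 .$$ (iv) With $U_i=\dfrac14\,\dfrac{u_i'(s_i)^2}{(u_i+a)(u_i+b)(u_i+c)}$ one has $U_1=-U_2=U_3=\dfrac1{a-c}$. -/

import Mathlib

open Set

noncomputable section

/-- Legendre's incomplete elliptic integral of the first kind,
`F(φ, k) = ∫_0^φ dθ / √(1 - k² sin² θ)`, for a real modulus `k` with `k² < 1`. -/
def ellipticF (k φ : ℝ) : ℝ :=
  ∫ θ in (0 : ℝ)..φ, 1 / Real.sqrt (1 - k ^ 2 * Real.sin θ ^ 2)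

/-- The complete elliptic integral of the first kind, `K(k) = F(π/2, k)`. -/
def ellipticK (k : ℝ) : ℝ := ellipticF k (Real.pi / 2)

/-- Jacobi's amplitude `am(u, k)`: the inverse function of `φ ↦ F(φ, k)`, which for `k² < 1` is an
increasing bijection of `ℝ` onto itself. -/
def jacobiAm (k u : ℝ) : ℝ := Function.invFun (ellipticF k) u

/-- `sn(u, k) = sin am(u, k)`. -/
def jacobiSn (k u : ℝ) : ℝ := Real.sin (jacobiAm k u)

/-- `cn(u, k) = cos am(u, k)`. -/
def jacobiCn (k u : ℝ) : ℝ := Real.cos (jacobiAm k u)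

/-- `dn(u, k) = √(1 - k² sn²(u, k))`. -/
def jacobiDn (k u : ℝ) : ℝ := Real.sqrt (1 - k ^ 2 * jacobiSn k u ^ 2)

/-- `ns = 1 / sn`. -/
def jacobiNs (k u : ℝ) : ℝ := 1 / jacobiSn k u

/-- `ds = dn / sn`. -/
def jacobiDs (k u : ℝ) : ℝ := jacobiDn k u / jacobiSn k u

/-- `cs = cn / sn`. -/
def jacobiCs (k u : ℝ) : ℝ := jacobiCn k u / jacobiSn k u

/-- Euclidean three-space. -/
abbrev E3 : Type := EuclideanSpace ℝ (Fin 3)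

/-- The cross product of two vectors of Euclidean three-space. -/
def cross3 (v w : E3) : E3 := WithLp.toLp 2 (crossProduct (WithLp.ofLp v) (WithLp.ofLp w))

/-- The unit normal `N = X_p × X_q / |X_p × X_q|` of a parametrised surface `X(p, q)`. -/
def unitNormal (X : ℝ × ℝ → E3) (t : ℝ × ℝ) : E3 :=
  ‖cross3 (fderiv ℝ X t (1, 0)) (fderiv ℝ X t (0, 1))‖⁻¹ •
    cross3 (fderiv ℝ X t (1, 0)) (fderiv ℝ X t (0, 1))

/-- The second fundamental form `II = -dX · dN` of a parametrised surface, as a bilinear form on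
the parameter plane. -/
def secondFundamentalForm (X : ℝ × ℝ → E3) (t v w : ℝ × ℝ) : ℝ :=
  -inner ℝ (fderiv ℝ X t v) (fderiv ℝ (unitNormal X) t w)

/-- The form `II` of the surface `X(p, q)` is, at the parameter value `t`, a nonzero multiple of
`dp² + ε dq²`. -/
def SecondFormConformalTo (ε : ℝ) (X : ℝ × ℝ → E3) (t : ℝ × ℝ) : Prop :=
  ∃ μ : ℝ, μ ≠ 0 ∧ ∀ v w : ℝ × ℝ,
    secondFundamentalForm X t v w = μ * (v.1 * w.1 + ε * (v.2 * w.2))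

/-- The point `p` lies on the confocal quadric
`x² / (lam + a) + y² / (lam + b) + z² / (lam + c) = 1`. -/
def OnConfocalQuadric (a b c lam : ℝ) (p : E3) : Prop :=
  p 0 ^ 2 / (lam + a) + p 1 ^ 2 / (lam + b) + p 2 ^ 2 / (lam + c) = 1

/-- `√(a-c) (sn s₁ dn s₂ ns s₃, cn s₁ cn s₂ ds s₃, dn s₁ sn s₂ cs s₃)`, with modulus `kᵢ` for `sᵢ`. -/
def ellipticParam (a c k₁ k₂ k₃ s₁ s₂ s₃ : ℝ) : E3 :=
  Real.sqrt (a - c) •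
    !₂[jacobiSn k₁ s₁ * jacobiDn k₂ s₂ * jacobiNs k₃ s₃,
       jacobiCn k₁ s₁ * jacobiCn k₂ s₂ * jacobiDs k₃ s₃,
       jacobiDn k₁ s₁ * jacobiSn k₂ s₂ * jacobiCs k₃ s₃]

/-- The confocal coordinate `u₁ = f₁² - a` with `f₁ = √(a-b) sn(s₁, k₁)`. -/
def confocalU1 (a b k₁ s₁ : ℝ) : ℝ := (Real.sqrt (a - b) * jacobiSn k₁ s₁) ^ 2 - a

/-- The confocal coordinate `u₂ = f₂² - a` with `f₂ = √(b-c) dn(s₂, k₂) / k₂`. -/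
def confocalU2 (a b c k₂ s₂ : ℝ) : ℝ := (Real.sqrt (b - c) * (jacobiDn k₂ s₂ / k₂)) ^ 2 - a

/-- The confocal coordinate `u₃ = f₃² - a` with `f₃ = √(a-c) ns(s₃, k₃)`. -/
def confocalU3 (a c k₃ s₃ : ℝ) : ℝ := (Real.sqrt (a - c) * jacobiNs k₃ s₃) ^ 2 - a

/-- The function `U = (1/4) u'² / ((u + a) (u + b) (u + c))` attached to a parametrisation
`u = u(s)` of a confocal coordinate. -/
def bigU (a b c : ℝ) (u : ℝ → ℝ) (s : ℝ) : ℝ :=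
  1 / 4 * (deriv u s ^ 2 / ((u s + a) * (u s + b) * (u s + c)))

end

/-!
For `k² < 1` the incomplete integral `F(·, k)` has a positive derivative which is at least `1`, so it
is an increasing bijection of `ℝ`, and the amplitude is its differentiable inverse with derivative
`dn`. This yields the classical derivatives and quadratic relations of `sn, cn, dn, ns, cs, ds`, and
the fact that `sn` maps `(0, K)` bijectively onto `(0, 1)` (`bijOn_jacobiSn`).

Since `a - b = k₁² (a - c)` and `b - c = k₂² (a - c)`, the numbers `uᵢ + a`, `uᵢ + b`, `uᵢ + c` are,
up to sign and constants, squares of Jacobi functions (`confocalU1_add`, `confocalU2_add`,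
`confocalU3_add`). The bijectivity, the ordering of the `uᵢ`, the equations of the three quadrics
and the values of the `Uᵢ` all follow from these factorisations.

For the second fundamental forms, the coordinate system is orthogonal, and the cross product of two
of the partial derivatives of `r` is an explicit multiple, of constant sign, of the third one. So
the unit normal of a coordinate surface is the normalisation of the third partial derivative
`± r_{s_l}`, and since this field is orthogonal to the surface, its length need not be
differentiated (`secondFundamentalForm_eq`): the entries of `II` are the products of `r_{s_i}` with
`r_{s_k s_l}`, up to a common factor. As `r` has the separated form `xⱼ = Pⱼ(s₁) Qⱼ(s₂) Vⱼ(s₃)`,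
both partial derivatives are again of this form, and the entries reduce to polynomial identities in
the Jacobi functions (`secondFormConformalTo_productSurface`). The diagonal entries equal, up to a
nonzero constant, a difference of two of the `uᵢ` times the derivative of the third, which does not
vanish.
-/

open Filter Topology

/-! ### Jacobi elliptic functions of a real variable -/

section Jacobi

variable {k : ℝ}

lemma one_sub_sq_mul_sin_sq_pos (hk : k ^ 2 < 1) (θ : ℝ) : 0 < 1 - k ^ 2 * Real.sin θ ^ 2 := by
  nlinarith [Real.sin_sq_le_one θ, sq_nonneg k, sq_nonneg (Real.sin θ)]

lemma continuous_ellipticF_integrand (hk : k ^ 2 < 1) :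
    Continuous fun θ : ℝ => 1 / Real.sqrt (1 - k ^ 2 * Real.sin θ ^ 2) := by
  refine continuous_const.div (by fun_prop) fun θ => ?_
  exact (Real.sqrt_pos.2 (one_sub_sq_mul_sin_sq_pos hk θ)).ne'

lemma hasDerivAt_ellipticF (hk : k ^ 2 < 1) (φ : ℝ) :
    HasDerivAt (ellipticF k) (1 / Real.sqrt (1 - k ^ 2 * Real.sin φ ^ 2)) φ :=
  intervalIntegral.integral_hasDerivAt_right
    ((continuous_ellipticF_integrand hk).intervalIntegrable _ _)
    ((continuous_ellipticF_integrand hk).stronglyMeasurableAtFilter _ _)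
    (continuous_ellipticF_integrand hk).continuousAt

lemma ellipticF_zero : ellipticF k 0 = 0 := by simp [ellipticF]

lemma strictMono_ellipticF (hk : k ^ 2 < 1) : StrictMono (ellipticF k) :=
  strictMono_of_hasDerivAt_pos (hasDerivAt_ellipticF hk) fun θ =>
    one_div_pos.2 (Real.sqrt_pos.2 (one_sub_sq_mul_sin_sq_pos hk θ))

/-- The integrand of `F` is at least `1`, so `F(φ, k) - φ` is monotone; this makes `F` unbounded
in both directions. -/
lemma monotone_ellipticF_sub_id (hk : k ^ 2 < 1) : Monotone fun φ => ellipticF k φ - φ := by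
  refine monotone_of_hasDerivAt_nonneg
    (fun φ => (hasDerivAt_ellipticF hk φ).sub (hasDerivAt_id φ)) fun θ => ?_
  have h := one_sub_sq_mul_sin_sq_pos hk θ
  have : Real.sqrt (1 - k ^ 2 * Real.sin θ ^ 2) ≤ 1 :=
    Real.sqrt_le_one.2 (by nlinarith [mul_nonneg (sq_nonneg k) (sq_nonneg (Real.sin θ))])
  exact sub_nonneg.2 ((one_le_div (Real.sqrt_pos.2 h)).2 this)

lemma surjective_ellipticF (hk : k ^ 2 < 1) : Function.Surjective (ellipticF k) := by
  have hc : Continuous (ellipticF k) :=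
    continuous_iff_continuousAt.2 fun φ => (hasDerivAt_ellipticF hk φ).continuousAt
  have h0 : ellipticF k 0 = 0 := ellipticF_zero
  refine hc.surjective ?_ ?_
  · refine tendsto_atTop_mono' _ ?_ tendsto_id
    filter_upwards [eventually_ge_atTop 0] with φ hφ
    have := monotone_ellipticF_sub_id hk hφ
    simp only [h0] at this
    simp only [id]; linarith
  · refine tendsto_atBot_mono' _ ?_ tendsto_id
    filter_upwards [eventually_le_atBot 0] with φ hφ
    have := monotone_ellipticF_sub_id hk hφ
    simp only [h0] at this
    simp only [id]; linarith

lemma ellipticF_jacobiAm (hk : k ^ 2 < 1) (u : ℝ) : ellipticF k (jacobiAm k u) = u :=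
  Function.rightInverse_invFun (surjective_ellipticF hk) u

lemma jacobiAm_ellipticF (hk : k ^ 2 < 1) (φ : ℝ) : jacobiAm k (ellipticF k φ) = φ :=
  Function.leftInverse_invFun (strictMono_ellipticF hk).injective φ

lemma strictMono_jacobiAm (hk : k ^ 2 < 1) : StrictMono (jacobiAm k) := fun u v h => by
  rw [← (strictMono_ellipticF hk).lt_iff_lt]
  simpa only [ellipticF_jacobiAm hk] using h

lemma continuous_jacobiAm (hk : k ^ 2 < 1) : Continuous (jacobiAm k) :=
  (strictMono_jacobiAm hk).monotone.continuous_of_surjective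
    fun φ => ⟨_, jacobiAm_ellipticF hk φ⟩

lemma jacobiDn_pos (hk : k ^ 2 < 1) (u : ℝ) : 0 < jacobiDn k u :=
  Real.sqrt_pos.2 (one_sub_sq_mul_sin_sq_pos hk _)

lemma jacobiCn_sq (k u : ℝ) : jacobiCn k u ^ 2 = 1 - jacobiSn k u ^ 2 :=
  Real.cos_sq' _

lemma jacobiDn_sq (hk : k ^ 2 < 1) (u : ℝ) : jacobiDn k u ^ 2 = 1 - k ^ 2 * jacobiSn k u ^ 2 :=
  Real.sq_sqrt (one_sub_sq_mul_sin_sq_pos hk _).le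

lemma hasDerivAt_jacobiAm (hk : k ^ 2 < 1) (u : ℝ) :
    HasDerivAt (jacobiAm k) (jacobiDn k u) u := by
  have h := HasDerivAt.of_local_left_inverse (continuous_jacobiAm hk).continuousAt
    (hasDerivAt_ellipticF hk (jacobiAm k u))
    (one_div_pos.2 (Real.sqrt_pos.2 (one_sub_sq_mul_sin_sq_pos hk _))).ne'
    (Eventually.of_forall (ellipticF_jacobiAm hk))
  simpa [jacobiDn, jacobiSn] using h

lemma hasDerivAt_jacobiSn (hk : k ^ 2 < 1) (u : ℝ) :
    HasDerivAt (jacobiSn k) (jacobiCn k u * jacobiDn k u) u :=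
  (hasDerivAt_jacobiAm hk u).sin

lemma hasDerivAt_jacobiCn (hk : k ^ 2 < 1) (u : ℝ) :
    HasDerivAt (jacobiCn k) (-(jacobiSn k u * jacobiDn k u)) u := by
  have h := (hasDerivAt_jacobiAm hk u).cos
  rwa [neg_mul] at h

lemma hasDerivAt_jacobiDn (hk : k ^ 2 < 1) (u : ℝ) :
    HasDerivAt (jacobiDn k) (-(k ^ 2 * jacobiSn k u * jacobiCn k u)) u := by
  have hd := jacobiDn_pos hk u
  have h := ((((hasDerivAt_jacobiSn hk u).pow 2).const_mul (k ^ 2)).const_sub 1).sqrt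
    (one_sub_sq_mul_sin_sq_pos hk _).ne'
  refine h.congr_deriv ?_
  change _ / (2 * jacobiDn k u) = _
  field_simp
  simp
  ring

lemma continuous_jacobiSn (hk : k ^ 2 < 1) : Continuous (jacobiSn k) :=
  Real.continuous_sin.comp (continuous_jacobiAm hk)

lemma jacobiCs_sq {u : ℝ} (hu : jacobiSn k u ≠ 0) : jacobiCs k u ^ 2 = jacobiNs k u ^ 2 - 1 := by
  rw [jacobiCs, jacobiNs, div_pow, jacobiCn_sq]
  field_simp

lemma jacobiDs_sq (hk : k ^ 2 < 1) {u : ℝ} (hu : jacobiSn k u ≠ 0) :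
    jacobiDs k u ^ 2 = jacobiNs k u ^ 2 - k ^ 2 := by
  rw [jacobiDs, jacobiNs, div_pow, jacobiDn_sq hk]
  field_simp

lemma continuous_jacobiCn (hk : k ^ 2 < 1) : Continuous (jacobiCn k) :=
  Real.continuous_cos.comp (continuous_jacobiAm hk)

lemma hasDerivAt_jacobiNs (hk : k ^ 2 < 1) {u : ℝ} (hu : jacobiSn k u ≠ 0) :
    HasDerivAt (jacobiNs k) (-(jacobiCs k u * jacobiDs k u)) u := by
  refine ((hasDerivAt_const u (1 : ℝ)).fun_div (hasDerivAt_jacobiSn hk u) hu).congr_deriv ?_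
  simp only [jacobiCs, jacobiDs]
  field_simp
  ring

lemma hasDerivAt_jacobiDs (hk : k ^ 2 < 1) {u : ℝ} (hu : jacobiSn k u ≠ 0) :
    HasDerivAt (jacobiDs k) (-(jacobiNs k u * jacobiCs k u)) u := by
  refine ((hasDerivAt_jacobiDn hk u).fun_div (hasDerivAt_jacobiSn hk u) hu).congr_deriv ?_
  have h := jacobiDn_sq hk u
  simp only [jacobiCs, jacobiNs]
  field_simp
  linear_combination -(jacobiCn k u) * h

lemma hasDerivAt_jacobiCs (hk : k ^ 2 < 1) {u : ℝ} (hu : jacobiSn k u ≠ 0) :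
    HasDerivAt (jacobiCs k) (-(jacobiNs k u * jacobiDs k u)) u := by
  refine ((hasDerivAt_jacobiCn hk u).fun_div (hasDerivAt_jacobiSn hk u) hu).congr_deriv ?_
  have h := jacobiCn_sq k u
  simp only [jacobiNs, jacobiDs]
  field_simp
  linear_combination -(jacobiDn k u) * h

/-- On a quarter period `sn` runs bijectively through `(0, 1)`. -/
lemma bijOn_jacobiSn (hk : k ^ 2 < 1) :
    BijOn (jacobiSn k) (Ioo 0 (ellipticK k)) (Ioo 0 1) := by
  have ham : BijOn (jacobiAm k) (Ioo 0 (ellipticK k)) (Ioo 0 (Real.pi / 2)) := by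
    have hF := strictMono_ellipticF hk
    refine ⟨fun u hu => ?_, (strictMono_jacobiAm hk).injective.injOn, fun φ hφ => ?_⟩
    · constructor
      · rw [← hF.lt_iff_lt, ellipticF_jacobiAm hk, ellipticF_zero]; exact hu.1
      · rw [← hF.lt_iff_lt, ellipticF_jacobiAm hk]; exact hu.2
    · refine ⟨ellipticF k φ, ⟨?_, hF hφ.2⟩, jacobiAm_ellipticF hk φ⟩
      rw [← ellipticF_zero (k := k)]; exact hF hφ.1
  have hsin : BijOn Real.sin (Ioo 0 (Real.pi / 2)) (Ioo 0 1) := by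
    have hinj : InjOn Real.sin (Ioo 0 (Real.pi / 2)) := by
      refine Real.strictMonoOn_sin.injOn.mono (Ioo_subset_Icc_self.trans (Icc_subset_Icc ?_ le_rfl))
      linarith [Real.pi_pos]
    refine ⟨fun φ hφ => ⟨Real.sin_pos_of_pos_of_lt_pi hφ.1 (by linarith [hφ.2, hφ.1]), ?_⟩,
      hinj,
      fun x hx => ⟨Real.arcsin x, ⟨Real.arcsin_pos.2 hx.1, Real.arcsin_lt_pi_div_two.2 hx.2⟩,
        Real.sin_arcsin (by linarith [hx.1]) hx.2.le⟩⟩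
    have := Real.sin_lt_sin_of_lt_of_le_pi_div_two (by linarith [hφ.1, hφ.2]) le_rfl hφ.2
    rwa [Real.sin_pi_div_two] at this
  exact hsin.comp ham

end Jacobi

/-! ### The second fundamental form of a surface with separated coordinates -/

section Surface

/-- The surface in `ℝ³` whose `i`-th coordinate is `P i p * Q i q * v i`. -/
def productSurface (P Q : Fin 3 → ℝ → ℝ) (v : Fin 3 → ℝ) (t : ℝ × ℝ) : E3 :=
  WithLp.toLp 2 fun i => P i t.1 * Q i t.2 * v i

lemma hasFDerivAt_productSurface {P Q : Fin 3 → ℝ → ℝ} {P' Q' : Fin 3 → ℝ} {v : Fin 3 → ℝ}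
    {t : ℝ × ℝ} (hP : ∀ i, HasDerivAt (P i) (P' i) t.1) (hQ : ∀ i, HasDerivAt (Q i) (Q' i) t.2) :
    ∃ L : ℝ × ℝ →L[ℝ] E3, HasFDerivAt (productSurface P Q v) L t ∧
      ∀ w, L w = WithLp.toLp 2 fun i => (P' i * Q i t.2 * w.1 + P i t.1 * Q' i * w.2) * v i := by
  let L : Fin 3 → (ℝ × ℝ →L[ℝ] ℝ) := fun i =>
    (P i t.1 • Q' i • ContinuousLinearMap.snd ℝ ℝ ℝ
      + Q i t.2 • P' i • ContinuousLinearMap.fst ℝ ℝ ℝ).smulRight (v i)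
  refine ⟨(PiLp.continuousLinearEquiv 2 ℝ (fun _ : Fin 3 => ℝ)).symm.toContinuousLinearMap ∘L
    ContinuousLinearMap.pi L, ?_, fun w => ?_⟩
  · refine (PiLp.hasFDerivAt_toLp 2 _).comp t (hasFDerivAt_pi.2 fun i => ?_)
    have h1 := (hP i).comp_hasFDerivAt t (hasFDerivAt_fst (𝕜 := ℝ) (p := t))
    have h2 := (hQ i).comp_hasFDerivAt t (hasFDerivAt_snd (𝕜 := ℝ) (p := t))
    refine ((h1.mul h2).mul_const (v i)).congr_fderiv ?_
    ext <;> simp [L] <;> ring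
  · ext i
    change (P i t.1 * (Q' i * w.2) + Q i t.2 * (P' i * w.1)) * v i = _
    ring

/-- If the normal direction `X_p × X_q` is a positive multiple of a differentiable field `Y`, the
derivative of the length `‖Y‖` drops out of the second fundamental form, because `Y` is orthogonal
to the surface. -/
lemma secondFundamentalForm_eq {X Y : ℝ × ℝ → E3} {t : ℝ × ℝ} {Y' : ℝ × ℝ →L[ℝ] E3}
    {g : ℝ × ℝ → ℝ} (hY : HasFDerivAt Y Y' t) (hY0 : Y t ≠ 0)
    (hg : ∀ᶠ s in 𝓝 t, 0 < g s ∧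
      cross3 (fderiv ℝ X s (1, 0)) (fderiv ℝ X s (0, 1)) = g s • Y s) (v w : ℝ × ℝ) :
    secondFundamentalForm X t v w = -(‖Y t‖⁻¹ * inner ℝ (fderiv ℝ X t v) (Y' w)) := by
  have hN : unitNormal X =ᶠ[𝓝 t] fun s => ‖Y s‖⁻¹ • Y s := by
    filter_upwards [hg] with s hs
    rw [unitNormal, hs.2, norm_smul, Real.norm_eq_abs, abs_of_pos hs.1, smul_smul, mul_inv,
      mul_right_comm, inv_mul_cancel₀ hs.1.ne', one_mul]
  have hn : DifferentiableAt ℝ (fun s => ‖Y s‖⁻¹) t :=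
    (hY.differentiableAt.norm ℝ hY0).inv (norm_ne_zero_iff.2 hY0)
  have horth : inner ℝ (fderiv ℝ X t v) (Y t) = (0 : ℝ) := by
    obtain ⟨hg0, hc⟩ := hg.self_of_nhds
    have hv : v = v.1 • ((1 : ℝ), (0 : ℝ)) + v.2 • ((0 : ℝ), (1 : ℝ)) := by ext <;> simp
    have key : ∀ x y : E3, inner ℝ x (cross3 x y) = (0 : ℝ) ∧ inner ℝ y (cross3 x y) = (0 : ℝ) := by
      intro x y
      constructor <;>
        simp [cross3, PiLp.inner_apply, Fin.sum_univ_three, crossProduct] <;> ring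
    have h1 := (key (fderiv ℝ X t (1, 0)) (fderiv ℝ X t (0, 1))).1
    have h2 := (key (fderiv ℝ X t (1, 0)) (fderiv ℝ X t (0, 1))).2
    rw [hc, inner_smul_right, mul_eq_zero, or_iff_right hg0.ne'] at h1 h2
    rw [hv, map_add, map_smul, map_smul, inner_add_left, inner_smul_left, inner_smul_left, h1, h2]
    simp
  rw [secondFundamentalForm, hN.fderiv_eq, (hn.hasFDerivAt.fun_smul hY).fderiv]
  simp [inner_add_right, inner_smul_right, horth]

/-- For a surface `X = (P i * Q i * v i)` whose normal direction is `Y = (P i * Q i * w i)`, the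
second fundamental form is the symmetric form with entries `∑ X_p Y_p`, `∑ X_p Y_q`, `∑ X_q Y_q`,
up to a common factor. -/
lemma secondFormConformalTo_productSurface {P Q P' Q' : Fin 3 → ℝ → ℝ} {v w : Fin 3 → ℝ}
    {g : ℝ × ℝ → ℝ} {t : ℝ × ℝ} {ε m : ℝ}
    (hP : ∀ᶠ p in 𝓝 t.1, ∀ i, HasDerivAt (P i) (P' i p) p)
    (hQ : ∀ᶠ q in 𝓝 t.2, ∀ i, HasDerivAt (Q i) (Q' i q) q)
    (hg : ∀ᶠ s in 𝓝 t, 0 < g s ∧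
      crossProduct (fun i => P' i s.1 * Q i s.2 * v i) (fun i => P i s.1 * Q' i s.2 * v i) =
        g s • fun i => P i s.1 * Q i s.2 * w i)
    (h0 : P 0 t.1 * Q 0 t.2 * w 0 ≠ 0) (hm : m ≠ 0)
    (h11 : ∑ i, (P' i t.1 * Q i t.2) ^ 2 * (v i * w i) = m)
    (h12 : ∑ i, (P' i t.1 * P i t.1) * (Q' i t.2 * Q i t.2) * (v i * w i) = 0)
    (h22 : ∑ i, (P i t.1 * Q' i t.2) ^ 2 * (v i * w i) = ε * m) :
    SecondFormConformalTo ε (productSurface P Q v) t := by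
  have hPt : ∀ᶠ s in 𝓝 t, ∀ i, HasDerivAt (P i) (P' i s.1) s.1 :=
    continuousAt_fst.eventually hP
  have hQt : ∀ᶠ s in 𝓝 t, ∀ i, HasDerivAt (Q i) (Q' i s.2) s.2 :=
    continuousAt_snd.eventually hQ
  obtain ⟨Y', hY, hY'⟩ := hasFDerivAt_productSurface (v := w) hPt.self_of_nhds hQt.self_of_nhds
  obtain ⟨X', hX, hX'⟩ := hasFDerivAt_productSurface (v := v) hPt.self_of_nhds hQt.self_of_nhds
  have hY0 : productSurface P Q w t ≠ 0 := fun h => h0 (by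
    have := congrArg (fun x : E3 => x 0) h
    simpa [productSurface] using this)
  have hcross : ∀ᶠ s in 𝓝 t, 0 < g s ∧
      cross3 (fderiv ℝ (productSurface P Q v) s (1, 0)) (fderiv ℝ (productSurface P Q v) s (0, 1))
        = g s • productSurface P Q w s := by
    filter_upwards [hPt, hQt, hg] with s hPs hQs hgs
    obtain ⟨L, hL, hL'⟩ := hasFDerivAt_productSurface (v := v) hPs hQs
    refine ⟨hgs.1, ?_⟩
    rw [hL.fderiv, hL', hL']
    simp only [mul_one, mul_zero, add_zero, zero_add]
    exact congrArg (WithLp.toLp 2) hgs.2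
  have hn : ‖productSurface P Q w t‖ ≠ 0 := norm_ne_zero_iff.2 hY0
  refine ⟨-(‖productSurface P Q w t‖⁻¹ * m), neg_ne_zero.2 (mul_ne_zero (inv_ne_zero hn) hm),
    fun x y => ?_⟩
  rw [secondFundamentalForm_eq hY hY0 hcross, hX.fderiv, hX', hY']
  simp only [Fin.sum_univ_three] at h11 h12 h22
  simp only [PiLp.inner_apply, Fin.sum_univ_three, RCLike.inner_apply, conj_trivial]
  linear_combination (-‖productSurface P Q w t‖⁻¹) * (x.1 * y.1 * h11 +
    (x.1 * y.2 + x.2 * y.1) * h12 + x.2 * y.2 * h22)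

end Surface

/-! ### The coordinate surfaces -/

section EllipticCoordinates

/-- The factors depending on the first variable in the three coordinates `x, y, z` of
`ellipticParam`. -/
noncomputable def factorOne (k : ℝ) : Fin 3 → ℝ → ℝ := ![jacobiSn k, jacobiCn k, jacobiDn k]

/-- The factors depending on the second variable in `x, y, z`. -/
noncomputable def factorTwo (k : ℝ) : Fin 3 → ℝ → ℝ := ![jacobiDn k, jacobiCn k, jacobiSn k]

/-- The factors depending on the third variable in `x, y, z`. -/
noncomputable def factorThree (k : ℝ) : Fin 3 → ℝ → ℝ := ![jacobiNs k, jacobiDs k, jacobiCs k]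

/-- The derivatives of `factorOne`, for `k² < 1`. -/
noncomputable def factorOneDeriv (k : ℝ) : Fin 3 → ℝ → ℝ :=
  ![fun s => jacobiCn k s * jacobiDn k s, fun s => -(jacobiSn k s * jacobiDn k s),
    fun s => -(k ^ 2 * jacobiSn k s * jacobiCn k s)]

/-- The derivatives of `factorTwo`, for `k² < 1`. -/
noncomputable def factorTwoDeriv (k : ℝ) : Fin 3 → ℝ → ℝ :=
  ![fun s => -(k ^ 2 * jacobiSn k s * jacobiCn k s), fun s => -(jacobiSn k s * jacobiDn k s),
    fun s => jacobiCn k s * jacobiDn k s]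

/-- The derivatives of `factorThree` where `sn ≠ 0`, for `k² < 1`, written without division so that
every identity below is polynomial in `sn, cn, dn` and `ns, cs, ds`. -/
noncomputable def factorThreeDeriv (k : ℝ) : Fin 3 → ℝ → ℝ :=
  ![fun s => -(jacobiCs k s * jacobiDs k s), fun s => -(jacobiNs k s * jacobiCs k s),
    fun s => -(jacobiNs k s * jacobiDs k s)]

variable {k : ℝ}

lemma hasDerivAt_factorOne (hk : k ^ 2 < 1) (s : ℝ) (i : Fin 3) :
    HasDerivAt (factorOne k i) (factorOneDeriv k i s) s := by
  fin_cases i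
  exacts [hasDerivAt_jacobiSn hk s, hasDerivAt_jacobiCn hk s, hasDerivAt_jacobiDn hk s]

lemma hasDerivAt_factorTwo (hk : k ^ 2 < 1) (s : ℝ) (i : Fin 3) :
    HasDerivAt (factorTwo k i) (factorTwoDeriv k i s) s := by
  fin_cases i
  exacts [hasDerivAt_jacobiDn hk s, hasDerivAt_jacobiCn hk s, hasDerivAt_jacobiSn hk s]

lemma hasDerivAt_factorThree (hk : k ^ 2 < 1) {s : ℝ} (hs : jacobiSn k s ≠ 0) (i : Fin 3) :
    HasDerivAt (factorThree k i) (factorThreeDeriv k i s) s := by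
  fin_cases i
  exacts [hasDerivAt_jacobiNs hk hs, hasDerivAt_jacobiDs hk hs, hasDerivAt_jacobiCs hk hs]

lemma ellipticParam_eq (a c k₁ k₂ k₃ s₁ s₂ s₃ : ℝ) :
    ellipticParam a c k₁ k₂ k₃ s₁ s₂ s₃ = WithLp.toLp 2 fun i =>
      Real.sqrt (a - c) * (factorOne k₁ i s₁ * factorTwo k₂ i s₂ * factorThree k₃ i s₃) := by
  ext i
  fin_cases i <;> simp [ellipticParam, factorOne, factorTwo, factorThree]

variable {l : ℝ}

/-- In units of `a - c` and up to the shift by `-a`, the confocal coordinates are `k² sn²(s₁)`,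
`dn²(s₂)` and `ns²(s₃)`. With `l² = 1 - k²`, the value `k²` separates the first from the second. -/
lemma sq_mul_jacobiSn_sq_lt_jacobiDn_sq (hl : l ^ 2 < 1) (hkl : l ^ 2 = 1 - k ^ 2) (hl0 : l ≠ 0)
    {q : ℝ} (hq : jacobiCn l q ≠ 0) (p : ℝ) :
    k ^ 2 * jacobiSn k p ^ 2 < jacobiDn l q ^ 2 := by
  have h1 : k ^ 2 * jacobiSn k p ^ 2 ≤ k ^ 2 :=
    mul_le_of_le_one_right (sq_nonneg k) (Real.sin_sq_le_one _)
  have h2 : 0 < l ^ 2 * jacobiCn l q ^ 2 := by positivity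
  rw [jacobiCn_sq] at h2
  rw [jacobiDn_sq hl]
  linarith

/-- The value `1` separates the second rescaled confocal coordinate from the third. -/
lemma jacobiDn_sq_lt_jacobiNs_sq (hl : l ^ 2 < 1) {s : ℝ} (hs : jacobiSn k s ≠ 0)
    (hs' : jacobiCn k s ≠ 0) (q : ℝ) :
    jacobiDn l q ^ 2 < jacobiNs k s ^ 2 := by
  have h1 : 0 ≤ l ^ 2 * jacobiSn l q ^ 2 := by positivity
  have h2 : 0 < jacobiCs k s ^ 2 := by rw [jacobiCs]; positivity
  rw [jacobiCs_sq hs] at h2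
  rw [jacobiDn_sq hl]
  linarith

/-- The first confocal coordinate stays below the third; unlike the two comparisons with the second
coordinate, this needs no condition on `cn`. -/
lemma sq_mul_jacobiSn_sq_lt_jacobiNs_sq (hk : k ^ 2 < 1) {s : ℝ} (hs : jacobiSn k s ≠ 0) (p : ℝ) :
    k ^ 2 * jacobiSn k p ^ 2 < jacobiNs k s ^ 2 := by
  have h1 : k ^ 2 * jacobiSn k p ^ 2 ≤ k ^ 2 :=
    mul_le_of_le_one_right (sq_nonneg k) (Real.sin_sq_le_one _)
  have h2 : 0 ≤ jacobiCs k s ^ 2 := sq_nonneg _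
  rw [jacobiCs_sq hs] at h2
  linarith

variable {a c s₁ s₂ s₃ : ℝ}

/-- The normal direction is `r_{s₃}`: the cross product `r_{s₁} × r_{s₂}` is
`√(a-c) (dn²(s₂) - k² sn²(s₁)) r_{s₃}`. -/
lemma secondFormConformalTo_one_two (hR : 0 < a - c) (hk : k ^ 2 < 1) (hl : l ^ 2 < 1)
    (hkl : l ^ 2 = 1 - k ^ 2) (hl0 : l ≠ 0) (h1 : jacobiSn k s₁ ≠ 0) (h2' : jacobiCn l s₂ ≠ 0)
    (h3 : jacobiSn k s₃ ≠ 0) (h3' : jacobiCn k s₃ ≠ 0) :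
    SecondFormConformalTo 1 (fun t => ellipticParam a c k l k t.1 t.2 s₃) (s₁, s₂) := by
  have hR0 : 0 < Real.sqrt (a - c) := Real.sqrt_pos.2 hR
  have hX : (fun t : ℝ × ℝ => ellipticParam a c k l k t.1 t.2 s₃) =
      productSurface (factorOne k) (factorTwo l)
        (fun i => Real.sqrt (a - c) * factorThree k i s₃) := by
    ext t i
    simp only [ellipticParam_eq, productSurface]
    ring
  rw [hX]
  generalize Real.sqrt (a - c) = R at hR0 ⊢
  have d2 := jacobiDn_pos hl s₂
  have d3 := jacobiDn_pos hk s₃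
  refine secondFormConformalTo_productSurface (P' := factorOneDeriv k) (Q' := factorTwoDeriv l)
    (w := fun i => R * factorThreeDeriv k i s₃)
    (g := fun t => R * (jacobiDn l t.2 ^ 2 - k ^ 2 * jacobiSn k t.1 ^ 2))
    (m := -(R ^ 2 * (jacobiNs k s₃ * jacobiCs k s₃ * jacobiDs k s₃) *
      (jacobiDn l s₂ ^ 2 - k ^ 2 * jacobiSn k s₁ ^ 2)))
    (.of_forall (hasDerivAt_factorOne hk)) (.of_forall (hasDerivAt_factorTwo hl)) ?_ ?_ ?_ ?_ ?_ ?_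
  · filter_upwards [continuousAt_snd.eventually
      ((continuous_jacobiCn hl).continuousAt.eventually_ne h2')] with t ht
    refine ⟨mul_pos hR0 (sub_pos.2 (sq_mul_jacobiSn_sq_lt_jacobiDn_sq hl hkl hl0 ht _)), ?_⟩
    have e1 := jacobiCn_sq k t.1
    have e2 := jacobiDn_sq hk t.1
    have e3 := jacobiCn_sq l t.2
    have e4 := jacobiDn_sq hl t.2
    have e5 := jacobiCs_sq h3
    have e6 := jacobiDs_sq hk h3
    -- each coordinate is a polynomial identity modulo `hkl` and `e1`, ..., `e6`
    rw [cross_apply]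
    ext i
    fin_cases i
    all_goals
      simp [factorOne, factorOneDeriv, factorTwo, factorTwoDeriv, factorThree, factorThreeDeriv]
      clear * - e1 e2 e3 e4 e5 e6 hkl
      grind
  · simp [factorOne, factorTwo, factorThreeDeriv, jacobiCs, jacobiDs, hR0.ne', d2.ne',
      d3.ne', h1, h3, h3']
  · have hgap := (sub_pos.2 (sq_mul_jacobiSn_sq_lt_jacobiDn_sq hl hkl hl0 h2' s₁)).ne'
    simp [jacobiNs, jacobiCs, jacobiDs, hR0.ne', d3.ne', h3, h3', hgap]
  all_goals
    simp only [factorOne, factorOneDeriv, factorTwo, factorTwoDeriv, factorThree, factorThreeDeriv,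
      Fin.sum_univ_three, Matrix.cons_val]
    have e1 := jacobiCn_sq k s₁
    have e2 := jacobiDn_sq hk s₁
    have e3 := jacobiCn_sq l s₂
    have e4 := jacobiDn_sq hl s₂
    have e5 := jacobiCs_sq h3
    have e6 := jacobiDs_sq hk h3
    clear * - e1 e2 e3 e4 e5 e6 hkl
    grind

/-- The normal direction is `-r_{s₂}`: the cross product `r_{s₁} × r_{s₃}` is
`-√(a-c) (ns²(s₃) - k² sn²(s₁)) r_{s₂}`. -/
lemma secondFormConformalTo_one_three (hR : 0 < a - c) (hk : k ^ 2 < 1) (hl : l ^ 2 < 1)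
    (hkl : l ^ 2 = 1 - k ^ 2) (hl0 : l ≠ 0) (h1 : jacobiSn k s₁ ≠ 0) (h2 : jacobiSn l s₂ ≠ 0)
    (h2' : jacobiCn l s₂ ≠ 0) (h3 : jacobiSn k s₃ ≠ 0) :
    SecondFormConformalTo (-1) (fun t => ellipticParam a c k l k t.1 s₂ t.2) (s₁, s₃) := by
  have hR0 : 0 < Real.sqrt (a - c) := Real.sqrt_pos.2 hR
  have hX : (fun t : ℝ × ℝ => ellipticParam a c k l k t.1 s₂ t.2) =
      productSurface (factorOne k) (factorThree k)
        (fun i => Real.sqrt (a - c) * factorTwo l i s₂) := by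
    ext t i
    simp only [ellipticParam_eq, productSurface]
    ring
  rw [hX]
  generalize Real.sqrt (a - c) = R at hR0 ⊢
  have d2 := jacobiDn_pos hl s₂
  refine secondFormConformalTo_productSurface (P' := factorOneDeriv k) (Q' := factorThreeDeriv k)
    (w := fun i => -(R * factorTwoDeriv l i s₂))
    (g := fun t => R * (jacobiNs k t.2 ^ 2 - k ^ 2 * jacobiSn k t.1 ^ 2))
    (m := R ^ 2 * (l ^ 2 * (jacobiSn l s₂ * jacobiCn l s₂ * jacobiDn l s₂)) *
      (jacobiNs k s₃ ^ 2 - k ^ 2 * jacobiSn k s₁ ^ 2))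
    (.of_forall (hasDerivAt_factorOne hk))
    ((continuous_jacobiSn hk).continuousAt.eventually_ne h3 |>.mono
      fun _ hs => hasDerivAt_factorThree hk hs) ?_ ?_ ?_ ?_ ?_ ?_
  · filter_upwards [continuousAt_snd.eventually
      ((continuous_jacobiSn hk).continuousAt.eventually_ne h3)] with t hs
    refine ⟨mul_pos hR0 (sub_pos.2 (sq_mul_jacobiSn_sq_lt_jacobiNs_sq hk hs _)), ?_⟩
    have e1 := jacobiCn_sq k t.1
    have e2 := jacobiDn_sq hk t.1
    have e3 := jacobiCn_sq l s₂
    have e4 := jacobiDn_sq hl s₂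
    have e5 := jacobiCs_sq hs
    have e6 := jacobiDs_sq hk hs
    -- each coordinate is a polynomial identity modulo `hkl` and `e1`, ..., `e6`
    rw [cross_apply]
    ext i
    fin_cases i
    all_goals
      simp [factorOne, factorOneDeriv, factorThree, factorThreeDeriv, factorTwo, factorTwoDeriv]
      clear * - e1 e2 e3 e4 e5 e6 hkl
      grind
  · simp [factorOne, factorThree, factorTwoDeriv, jacobiNs, hR0.ne', h1, h2, h2', h3, hl0]
  · have hgap := (sub_pos.2 (sq_mul_jacobiSn_sq_lt_jacobiNs_sq hk h3 s₁)).ne'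
    simp [hR0.ne', d2.ne', h2, h2', hl0, hgap]
  all_goals
    simp only [factorOne, factorOneDeriv, factorThree, factorThreeDeriv, factorTwo, factorTwoDeriv,
      Fin.sum_univ_three, Matrix.cons_val]
    have e1 := jacobiCn_sq k s₁
    have e2 := jacobiDn_sq hk s₁
    have e3 := jacobiCn_sq l s₂
    have e4 := jacobiDn_sq hl s₂
    have e5 := jacobiCs_sq h3
    have e6 := jacobiDs_sq hk h3
    clear * - e1 e2 e3 e4 e5 e6 hkl
    grind

/-- The normal direction is `r_{s₁}`: the cross product `r_{s₂} × r_{s₃}` is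
`√(a-c) (ns²(s₃) - dn²(s₂)) r_{s₁}`. -/
lemma secondFormConformalTo_two_three (hR : 0 < a - c) (hk : k ^ 2 < 1) (hl : l ^ 2 < 1)
    (hkl : l ^ 2 = 1 - k ^ 2) (hk0 : k ≠ 0) (h1 : jacobiSn k s₁ ≠ 0) (h1' : jacobiCn k s₁ ≠ 0)
    (h3 : jacobiSn k s₃ ≠ 0) (h3' : jacobiCn k s₃ ≠ 0) :
    SecondFormConformalTo 1 (fun t => ellipticParam a c k l k s₁ t.1 t.2) (s₂, s₃) := by
  have hR0 : 0 < Real.sqrt (a - c) := Real.sqrt_pos.2 hR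
  have hX : (fun t : ℝ × ℝ => ellipticParam a c k l k s₁ t.1 t.2) =
      productSurface (factorTwo l) (factorThree k)
        (fun i => Real.sqrt (a - c) * factorOne k i s₁) := by
    ext t i
    simp only [ellipticParam_eq, productSurface]
    ring
  rw [hX]
  generalize Real.sqrt (a - c) = R at hR0 ⊢
  have d1 := jacobiDn_pos hk s₁
  have d2 := jacobiDn_pos hl s₂
  refine secondFormConformalTo_productSurface (P' := factorTwoDeriv l) (Q' := factorThreeDeriv k)
    (w := fun i => R * factorOneDeriv k i s₁)
    (g := fun t => R * (jacobiNs k t.2 ^ 2 - jacobiDn l t.1 ^ 2))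
    (m := -(R ^ 2 * (k ^ 2 * (jacobiSn k s₁ * jacobiCn k s₁ * jacobiDn k s₁)) *
      (jacobiNs k s₃ ^ 2 - jacobiDn l s₂ ^ 2)))
    (.of_forall (hasDerivAt_factorTwo hl))
    ((continuous_jacobiSn hk).continuousAt.eventually_ne h3 |>.mono
      fun _ hs => hasDerivAt_factorThree hk hs) ?_ ?_ ?_ ?_ ?_ ?_
  · filter_upwards [continuousAt_snd.eventually
      ((continuous_jacobiSn hk).continuousAt.eventually_ne h3),
      continuousAt_snd.eventually
        ((continuous_jacobiCn hk).continuousAt.eventually_ne h3')] with t hs hs'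
    refine ⟨mul_pos hR0 (sub_pos.2 (jacobiDn_sq_lt_jacobiNs_sq hl hs hs' _)), ?_⟩
    have e1 := jacobiCn_sq k s₁
    have e2 := jacobiDn_sq hk s₁
    have e3 := jacobiCn_sq l t.1
    have e4 := jacobiDn_sq hl t.1
    have e5 := jacobiCs_sq hs
    have e6 := jacobiDs_sq hk hs
    -- each coordinate is a polynomial identity modulo `hkl` and `e1`, ..., `e6`
    rw [cross_apply]
    ext i
    fin_cases i
    all_goals
      simp [factorTwo, factorTwoDeriv, factorThree, factorThreeDeriv, factorOne, factorOneDeriv]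
      clear * - e1 e2 e3 e4 e5 e6 hkl
      grind
  · simp [factorTwo, factorThree, factorOneDeriv, jacobiNs, hR0.ne', d1.ne', d2.ne', h1', h3]
  · have hgap := (sub_pos.2 (jacobiDn_sq_lt_jacobiNs_sq hl h3 h3' s₂)).ne'
    simp [hR0.ne', d1.ne', h1, h1', hk0, hgap]
  all_goals
    simp only [factorTwo, factorTwoDeriv, factorThree, factorThreeDeriv, factorOne, factorOneDeriv,
      Fin.sum_univ_three, Matrix.cons_val]
    have e1 := jacobiCn_sq k s₁
    have e2 := jacobiDn_sq hk s₁
    have e3 := jacobiCn_sq l s₂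
    have e4 := jacobiDn_sq hl s₂
    have e5 := jacobiCs_sq h3
    have e6 := jacobiDs_sq hk h3
    clear * - e1 e2 e3 e4 e5 e6 hkl
    grind

end EllipticCoordinates

/-! ### The confocal coordinates -/

section ConfocalCoordinates

variable {a b c k l s : ℝ}

lemma confocalU1_eq (hab : b < a) (k s : ℝ) :
    confocalU1 a b k s = (a - b) * jacobiSn k s ^ 2 - a := by
  rw [confocalU1, mul_pow, Real.sq_sqrt (sub_pos.2 hab).le]

lemma confocalU2_eq (hbc : c < b) (hl0 : l ≠ 0) (hb : b - c = l ^ 2 * (a - c)) (s : ℝ) :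
    confocalU2 a b c l s = (a - c) * jacobiDn l s ^ 2 - a := by
  rw [confocalU2, mul_pow, Real.sq_sqrt (sub_pos.2 hbc).le, hb]
  field_simp

lemma confocalU3_eq (hac : c < a) (k s : ℝ) :
    confocalU3 a c k s = (a - c) * jacobiNs k s ^ 2 - a := by
  rw [confocalU3, mul_pow, Real.sq_sqrt (sub_pos.2 hac).le]

/-- The factorisations of `u₁ + a`, `u₁ + b`, `u₁ + c`. They give the signs of these numbers, the
denominators in the equation of the confocal quadric, and the denominator of `U₁`. -/
lemma confocalU1_add (hab : b < a) (hk : k ^ 2 < 1) (ha : a - b = k ^ 2 * (a - c)) (s : ℝ) :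
    confocalU1 a b k s + a = k ^ 2 * (a - c) * jacobiSn k s ^ 2 ∧
    confocalU1 a b k s + b = -(k ^ 2 * (a - c) * jacobiCn k s ^ 2) ∧
    confocalU1 a b k s + c = -((a - c) * jacobiDn k s ^ 2) := by
  rw [confocalU1_eq hab, jacobiCn_sq, jacobiDn_sq hk, ← ha]
  exact ⟨by ring, by ring, by linear_combination jacobiSn k s ^ 2 * ha⟩

lemma confocalU2_add (hbc : c < b) (hl : l ^ 2 < 1) (hl0 : l ≠ 0)
    (hb : b - c = l ^ 2 * (a - c)) (s : ℝ) :
    confocalU2 a b c l s + a = (a - c) * jacobiDn l s ^ 2 ∧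
    confocalU2 a b c l s + b = l ^ 2 * (a - c) * jacobiCn l s ^ 2 ∧
    confocalU2 a b c l s + c = -(l ^ 2 * (a - c) * jacobiSn l s ^ 2) := by
  rw [confocalU2_eq hbc hl0 hb, jacobiCn_sq, jacobiDn_sq hl]
  exact ⟨by ring, by linear_combination hb, by ring⟩

lemma confocalU3_add (hac : c < a) (hk : k ^ 2 < 1) (ha : a - b = k ^ 2 * (a - c))
    (hs : jacobiSn k s ≠ 0) :
    confocalU3 a c k s + a = (a - c) * jacobiNs k s ^ 2 ∧
    confocalU3 a c k s + b = (a - c) * jacobiDs k s ^ 2 ∧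
    confocalU3 a c k s + c = (a - c) * jacobiCs k s ^ 2 := by
  rw [confocalU3_eq hac, jacobiCs_sq hs, jacobiDs_sq hk hs]
  exact ⟨by ring, by linear_combination -ha, by ring⟩

lemma bijOn_jacobiSn_sq (hk : k ^ 2 < 1) :
    BijOn (fun s => jacobiSn k s ^ 2) (Ioo 0 (ellipticK k)) (Ioo 0 1) := by
  have hsq : BijOn (fun x : ℝ => x ^ 2) (Ioo 0 1) (Ioo 0 1) := by
    refine ⟨fun x hx => ⟨pow_pos hx.1 2, pow_lt_one₀ hx.1.le hx.2 two_ne_zero⟩,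
      fun x hx y hy h => (pow_left_inj₀ hx.1.le hy.1.le two_ne_zero).1 h, fun y hy =>
      ⟨√y, ⟨Real.sqrt_pos.2 hy.1, (Real.sqrt_lt' one_pos).2 (by simpa using hy.2)⟩,
        Real.sq_sqrt hy.1.le⟩⟩
  exact hsq.comp (bijOn_jacobiSn hk)

lemma bijOn_confocalU1 (hab : b < a) (hk : k ^ 2 < 1) :
    BijOn (confocalU1 a b k) (Ioo 0 (ellipticK k)) (Ioo (-a) (-b)) := by
  have h0 : 0 < a - b := sub_pos.2 hab
  have h : BijOn (fun x : ℝ => (a - b) * x - a) (Ioo 0 1) (Ioo (-a) (-b)) := by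
    refine ⟨fun x hx => ⟨?_, ?_⟩, fun x _ y _ h => ?_, fun y hy => ⟨(y + a) / (a - b), ⟨?_, ?_⟩, ?_⟩⟩
    · nlinarith [hx.1]
    · nlinarith [hx.2]
    · exact mul_left_cancel₀ h0.ne' (sub_left_injective h)
    · exact div_pos (by linarith [hy.1]) h0
    · exact (div_lt_one h0).2 (by linarith [hy.2])
    · field_simp; ring
  exact (h.comp (bijOn_jacobiSn_sq hk)).congr fun s _ => (confocalU1_eq hab k s).symm

lemma bijOn_confocalU2 (hbc : c < b) (hl : l ^ 2 < 1) (hl0 : l ≠ 0)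
    (hb : b - c = l ^ 2 * (a - c)) :
    BijOn (confocalU2 a b c l) (Ioo 0 (ellipticK l)) (Ioo (-b) (-c)) := by
  have h0 : 0 < b - c := sub_pos.2 hbc
  have h : BijOn (fun x : ℝ => -((b - c) * x) - c) (Ioo 0 1) (Ioo (-b) (-c)) := by
    refine ⟨fun x hx => ⟨?_, ?_⟩, fun x _ y _ h => ?_, fun y hy => ⟨(-c - y) / (b - c), ⟨?_, ?_⟩, ?_⟩⟩
    · nlinarith [hx.2]
    · nlinarith [hx.1]
    · exact mul_left_cancel₀ h0.ne' (neg_injective (sub_left_injective h))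
    · exact div_pos (by linarith [hy.2]) h0
    · exact (div_lt_one h0).2 (by linarith [hy.1])
    · field_simp; ring
  refine (h.comp (bijOn_jacobiSn_sq hl)).congr fun s _ => ?_
  have := (confocalU2_add hbc hl hl0 hb s).2.2
  simp only [Function.comp_apply]
  rw [hb]
  linarith

lemma bijOn_confocalU3 (hac : c < a) (hk : k ^ 2 < 1) :
    BijOn (confocalU3 a c k) (Ioo 0 (ellipticK k)) (Ioi (-c)) := by
  have h0 : 0 < a - c := sub_pos.2 hac
  have h : BijOn (fun x : ℝ => (a - c) / x - a) (Ioo 0 1) (Ioi (-c)) := by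
    refine ⟨fun x hx => ?_, fun x _ y _ h => ?_, fun y hy => ⟨(a - c) / (y + a), ⟨?_, ?_⟩, ?_⟩⟩
    · have := (lt_div_iff₀ hx.1).2 (mul_lt_of_lt_one_right h0 hx.2)
      simp only [mem_Ioi]; linarith
    · have := sub_left_injective h
      rw [div_eq_mul_inv, div_eq_mul_inv] at this
      exact inv_injective (mul_left_cancel₀ h0.ne' this)
    · have : -c < y := hy
      exact div_pos h0 (by linarith)
    · have : -c < y := hy
      exact (div_lt_one (by linarith)).2 (by linarith)
    · simp only [div_div_cancel₀ h0.ne']; ring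
  refine (h.comp (bijOn_jacobiSn_sq hk)).congr fun s _ => ?_
  simp only [Function.comp_apply]
  rw [confocalU3_eq hac, jacobiNs]
  ring

variable {s₁ s₂ s₃ : ℝ}

/-- The squared Cartesian coordinates, which are all that enters the equation of a quadric. -/
lemma ellipticParam_sq (hac : c < a) (k₁ k₂ k₃ s₁ s₂ s₃ : ℝ) :
    ellipticParam a c k₁ k₂ k₃ s₁ s₂ s₃ 0 ^ 2 =
      (a - c) * (jacobiSn k₁ s₁ ^ 2 * jacobiDn k₂ s₂ ^ 2 * jacobiNs k₃ s₃ ^ 2) ∧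
    ellipticParam a c k₁ k₂ k₃ s₁ s₂ s₃ 1 ^ 2 =
      (a - c) * (jacobiCn k₁ s₁ ^ 2 * jacobiCn k₂ s₂ ^ 2 * jacobiDs k₃ s₃ ^ 2) ∧
    ellipticParam a c k₁ k₂ k₃ s₁ s₂ s₃ 2 ^ 2 =
      (a - c) * (jacobiDn k₁ s₁ ^ 2 * jacobiSn k₂ s₂ ^ 2 * jacobiCs k₃ s₃ ^ 2) := by
  have h := Real.sq_sqrt (sub_pos.2 hac).le
  refine ⟨?_, ?_, ?_⟩ <;> simp [ellipticParam, mul_pow, h]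

lemma onConfocalQuadric_confocalU1 (hab : b < a) (hac : c < a) (hk : k ^ 2 < 1) (hl : l ^ 2 < 1)
    (hkl : l ^ 2 = 1 - k ^ 2) (hk0 : k ≠ 0) (ha : a - b = k ^ 2 * (a - c))
    (h1 : jacobiSn k s₁ ≠ 0) (h1' : jacobiCn k s₁ ≠ 0) (h3 : jacobiSn k s₃ ≠ 0) :
    OnConfocalQuadric a b c (confocalU1 a b k s₁) (ellipticParam a c k l k s₁ s₂ s₃) := by
  have h0 : a - c ≠ 0 := (sub_pos.2 hac).ne'
  have hd := (jacobiDn_pos hk s₁).ne'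
  obtain ⟨ea, eb, ec⟩ := confocalU1_add hab hk ha s₁
  obtain ⟨x, y, z⟩ := ellipticParam_sq hac k l k s₁ s₂ s₃
  rw [OnConfocalQuadric, ea, eb, ec, x, y, z]
  field_simp
  rw [jacobiCn_sq, jacobiDn_sq hl, jacobiDs_sq hk h3, jacobiCs_sq h3, hkl]
  ring

lemma onConfocalQuadric_confocalU2 (hbc : c < b) (hac : c < a) (hk : k ^ 2 < 1) (hl : l ^ 2 < 1)
    (hkl : l ^ 2 = 1 - k ^ 2) (hl0 : l ≠ 0) (hb : b - c = l ^ 2 * (a - c))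
    (h2 : jacobiSn l s₂ ≠ 0) (h2' : jacobiCn l s₂ ≠ 0) (h3 : jacobiSn k s₃ ≠ 0) :
    OnConfocalQuadric a b c (confocalU2 a b c l s₂) (ellipticParam a c k l k s₁ s₂ s₃) := by
  have h0 : a - c ≠ 0 := (sub_pos.2 hac).ne'
  have hd := (jacobiDn_pos hl s₂).ne'
  obtain ⟨ea, eb, ec⟩ := confocalU2_add hbc hl hl0 hb s₂
  obtain ⟨x, y, z⟩ := ellipticParam_sq hac k l k s₁ s₂ s₃
  rw [OnConfocalQuadric, ea, eb, ec, x, y, z]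
  field_simp
  rw [jacobiCn_sq, jacobiDn_sq hk, jacobiDs_sq hk h3, jacobiCs_sq h3, hkl]
  ring

lemma onConfocalQuadric_confocalU3 (hac : c < a) (hk : k ^ 2 < 1) (hl : l ^ 2 < 1)
    (hkl : l ^ 2 = 1 - k ^ 2) (ha : a - b = k ^ 2 * (a - c))
    (h3 : jacobiSn k s₃ ≠ 0) (h3' : jacobiCn k s₃ ≠ 0) :
    OnConfocalQuadric a b c (confocalU3 a c k s₃) (ellipticParam a c k l k s₁ s₂ s₃) := by
  have h0 : a - c ≠ 0 := (sub_pos.2 hac).ne'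
  have hn : jacobiNs k s₃ ≠ 0 := one_div_ne_zero h3
  have hd : jacobiDs k s₃ ≠ 0 := div_ne_zero (jacobiDn_pos hk s₃).ne' h3
  have hc : jacobiCs k s₃ ≠ 0 := div_ne_zero h3' h3
  obtain ⟨ea, eb, ec⟩ := confocalU3_add hac hk ha h3
  obtain ⟨x, y, z⟩ := ellipticParam_sq hac k l k s₁ s₂ s₃
  rw [OnConfocalQuadric, ea, eb, ec, x, y, z]
  field_simp
  rw [jacobiCn_sq, jacobiCn_sq, jacobiDn_sq hk, jacobiDn_sq hl, hkl]
  ring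

lemma bigU_confocalU1 (hab : b < a) (hac : c < a) (hk : k ^ 2 < 1) (hk0 : k ≠ 0)
    (ha : a - b = k ^ 2 * (a - c)) (h : jacobiSn k s ≠ 0) (h' : jacobiCn k s ≠ 0) :
    bigU a b c (confocalU1 a b k) s = 1 / (a - c) := by
  have h0 : a - c ≠ 0 := (sub_pos.2 hac).ne'
  have hd := (jacobiDn_pos hk s).ne'
  have hu : deriv (confocalU1 a b k) s =
      k ^ 2 * (a - c) * (2 * jacobiSn k s * (jacobiCn k s * jacobiDn k s)) := by
    rw [funext (confocalU1_eq hab k), ha]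
    exact ((((hasDerivAt_jacobiSn hk s).fun_pow 2).const_mul _).sub_const a).deriv.trans (by simp)
  obtain ⟨ea, eb, ec⟩ := confocalU1_add hab hk ha s
  rw [bigU, hu, ea, eb, ec]
  field_simp
  norm_num

lemma bigU_confocalU2 (hbc : c < b) (hac : c < a) (hl : l ^ 2 < 1) (hl0 : l ≠ 0)
    (hb : b - c = l ^ 2 * (a - c)) (h : jacobiSn l s ≠ 0) (h' : jacobiCn l s ≠ 0) :
    -bigU a b c (confocalU2 a b c l) s = 1 / (a - c) := by
  have h0 : a - c ≠ 0 := (sub_pos.2 hac).ne'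
  have hd := (jacobiDn_pos hl s).ne'
  have hu : deriv (confocalU2 a b c l) s =
      (a - c) * (2 * jacobiDn l s * (-(l ^ 2 * jacobiSn l s * jacobiCn l s))) := by
    rw [funext (confocalU2_eq hbc hl0 hb)]
    exact ((((hasDerivAt_jacobiDn hl s).fun_pow 2).const_mul _).sub_const a).deriv.trans (by simp)
  obtain ⟨ea, eb, ec⟩ := confocalU2_add hbc hl hl0 hb s
  rw [bigU, hu, ea, eb, ec]
  field_simp
  norm_num

lemma bigU_confocalU3 (hac : c < a) (hk : k ^ 2 < 1) (ha : a - b = k ^ 2 * (a - c))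
    (h : jacobiSn k s ≠ 0) (h' : jacobiCn k s ≠ 0) :
    bigU a b c (confocalU3 a c k) s = 1 / (a - c) := by
  have h0 : a - c ≠ 0 := (sub_pos.2 hac).ne'
  have hn : jacobiNs k s ≠ 0 := one_div_ne_zero h
  have hd : jacobiDs k s ≠ 0 := div_ne_zero (jacobiDn_pos hk s).ne' h
  have hc : jacobiCs k s ≠ 0 := div_ne_zero h' h
  have hu : deriv (confocalU3 a c k) s =
      (a - c) * (2 * jacobiNs k s * (-(jacobiCs k s * jacobiDs k s))) := by
    rw [funext (confocalU3_eq hac k)]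
    exact ((((hasDerivAt_jacobiNs hk h).fun_pow 2).const_mul _).sub_const a).deriv.trans (by simp)
  obtain ⟨ea, eb, ec⟩ := confocalU3_add hac hk ha h
  rw [bigU, hu, ea, eb, ec]
  field_simp
  norm_num

end ConfocalCoordinates

theorem mainTheorem2 (a b c k₁ k₂ k₃ : ℝ) (hab : b < a) (hbc : c < b)
    (hk₁ : k₁ ^ 2 = (a - b) / (a - c)) (hk₂ : k₂ ^ 2 = (b - c) / (a - c)) (hk₃ : k₃ = k₁) :
    k₂ ^ 2 = 1 - k₁ ^ 2 ∧
    -- `uᵢ = uᵢ(sᵢ)` is a parametrisation of the confocal coordinates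
    Set.BijOn (confocalU1 a b k₁) (Set.Ioo 0 (ellipticK k₁)) (Set.Ioo (-a) (-b)) ∧
    Set.BijOn (confocalU2 a b c k₂) (Set.Ioo 0 (ellipticK k₂)) (Set.Ioo (-b) (-c)) ∧
    Set.BijOn (confocalU3 a c k₃) (Set.Ioo 0 (ellipticK k₃)) (Set.Ioi (-c)) ∧
    ∀ s₁ s₂ s₃ : ℝ,
      jacobiSn k₁ s₁ ≠ 0 → jacobiCn k₁ s₁ ≠ 0 →
      jacobiSn k₂ s₂ ≠ 0 → jacobiCn k₂ s₂ ≠ 0 →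
      jacobiSn k₃ s₃ ≠ 0 → jacobiCn k₃ s₃ ≠ 0 →
      -- the point is on the three confocal quadrics labelled by `u₁`, `u₂`, `u₃`
      (-a < confocalU1 a b k₁ s₁ ∧ confocalU1 a b k₁ s₁ < -b ∧
        -b < confocalU2 a b c k₂ s₂ ∧ confocalU2 a b c k₂ s₂ < -c ∧
        -c < confocalU3 a c k₃ s₃) ∧
      OnConfocalQuadric a b c (confocalU1 a b k₁ s₁) (ellipticParam a c k₁ k₂ k₃ s₁ s₂ s₃) ∧
      OnConfocalQuadric a b c (confocalU2 a b c k₂ s₂) (ellipticParam a c k₁ k₂ k₃ s₁ s₂ s₃) ∧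
      OnConfocalQuadric a b c (confocalU3 a c k₃ s₃) (ellipticParam a c k₁ k₂ k₃ s₁ s₂ s₃) ∧
      -- `II₁₂ ~ ds₁² + ds₂²`, `II₁₃ ~ ds₁² - ds₃²`, `II₂₃ ~ ds₂² + ds₃²`
      SecondFormConformalTo 1
        (fun t => ellipticParam a c k₁ k₂ k₃ t.1 t.2 s₃) (s₁, s₂) ∧
      SecondFormConformalTo (-1)
        (fun t => ellipticParam a c k₁ k₂ k₃ t.1 s₂ t.2) (s₁, s₃) ∧
      SecondFormConformalTo 1
        (fun t => ellipticParam a c k₁ k₂ k₃ s₁ t.1 t.2) (s₂, s₃) ∧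
      -- `U₁ = -U₂ = U₃ = 1 / (a - c)`
      bigU a b c (confocalU1 a b k₁) s₁ = 1 / (a - c) ∧
      -bigU a b c (confocalU2 a b c k₂) s₂ = 1 / (a - c) ∧
      bigU a b c (confocalU3 a c k₃) s₃ = 1 / (a - c) := by
  have hac : c < a := hbc.trans hab
  have h0 : 0 < a - c := sub_pos.2 hac
  subst hk₃
  have ha : a - b = k₃ ^ 2 * (a - c) := by rw [hk₁]; field_simp
  have hb : b - c = k₂ ^ 2 * (a - c) := by rw [hk₂]; field_simp
  have hkl : k₂ ^ 2 = 1 - k₃ ^ 2 := by rw [hk₁, hk₂]; field_simp; ring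
  have hk_pos : 0 < k₃ ^ 2 := hk₁ ▸ div_pos (sub_pos.2 hab) h0
  have hl_pos : 0 < k₂ ^ 2 := hk₂ ▸ div_pos (sub_pos.2 hbc) h0
  have hk : k₃ ^ 2 < 1 := by linarith
  have hl : k₂ ^ 2 < 1 := by linarith
  have hk0 : k₃ ≠ 0 := (pow_ne_zero_iff two_ne_zero).1 hk_pos.ne'
  have hl0 : k₂ ≠ 0 := (pow_ne_zero_iff two_ne_zero).1 hl_pos.ne'
  refine ⟨hkl, bijOn_confocalU1 hab hk, bijOn_confocalU2 hbc hl hl0 hb, bijOn_confocalU3 hac hk,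
    fun s₁ s₂ s₃ h1 h1' h2 h2' h3 h3' => ⟨?_,
      onConfocalQuadric_confocalU1 hab hac hk hl hkl hk0 ha h1 h1' h3,
      onConfocalQuadric_confocalU2 hbc hac hk hl hkl hl0 hb h2 h2' h3,
      onConfocalQuadric_confocalU3 hac hk hl hkl ha h3 h3',
      secondFormConformalTo_one_two h0 hk hl hkl hl0 h1 h2' h3 h3',
      secondFormConformalTo_one_three h0 hk hl hkl hl0 h1 h2 h2' h3,
      secondFormConformalTo_two_three h0 hk hl hkl hk0 h1 h1' h3 h3',
      bigU_confocalU1 hab hac hk hk0 ha h1 h1',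
      bigU_confocalU2 hbc hac hl hl0 hb h2 h2',
      bigU_confocalU3 hac hk ha h3 h3'⟩⟩
  obtain ⟨e1, e2, -⟩ := confocalU1_add hab hk ha s₁
  obtain ⟨-, e3, e4⟩ := confocalU2_add hbc hl hl0 hb s₂
  obtain ⟨-, -, e5⟩ := confocalU3_add hac hk ha h3
  have hc3 : jacobiCs k₃ s₃ ≠ 0 := div_ne_zero h3' h3
  have p1 : 0 < k₃ ^ 2 * (a - c) * jacobiSn k₃ s₁ ^ 2 := by positivity
  have p2 : 0 < k₃ ^ 2 * (a - c) * jacobiCn k₃ s₁ ^ 2 := by positivity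
  have p3 : 0 < k₂ ^ 2 * (a - c) * jacobiCn k₂ s₂ ^ 2 := by positivity
  have p4 : 0 < k₂ ^ 2 * (a - c) * jacobiSn k₂ s₂ ^ 2 := by positivity
  have p5 : 0 < (a - c) * jacobiCs k₃ s₃ ^ 2 := by positivity
  exact ⟨by linarith, by linarith, by linarith, by linarith, by linarith⟩
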